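/- Let $K$ be a field, $n\ge 0$ and $K[\mathbf x]=K[x_1,\dots,x_n]$. For a subset $S\subseteq\{1,\dots,n\}$ let $(x_i : i\in S)$ be the coordinate ideal with cloud $S$. An ideal $\mathcal I\subseteq K[\mathbf x]$ is called tame if the blowup of $\mathbb A^n_K=\operatorname{Spec}K[\mathbf x]$ with center $\mathcal I$ is smooth over $K$. (a) Let $\mathcal I=\prod_{i=1}^{s}\mathcal I_i$ be a product of coordinate ideals $\mathcal I_i=(x_k : k\in I_i)$, and let $\mathcal J$ be a coordinate ideal containing all the factors $\mathcal I_1,\dots,\mathcal I_s$ (equivalently, the cloud of $\mathcal J$ contains $I_1\cup\dots\cup I_s$). If $\mathcal I$ is tame, then $\mathcal I\cdot\mathcal J$ is tame. (b) In particular, if $I\subseteq J\subseteq\{1,\dots,n\}$, then the product $(x_i : i\in I)\cdot(x_j : j\in J)$ is tame. -/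

import Mathlib

open AlgebraicGeometry CategoryTheory

universe u

noncomputable section

namespace MonomialBlowup

section Rees

variable {R : Type u} [CommRing R] (I : Ideal R)

/-- The degree `d` part `I ^ d * t ^ d` of the Rees algebra `R[It] = ⨁ I ^ d * t ^ d`. -/
def reesGrading (d : ℕ) : Submodule R (reesAlgebra I) where
  carrier := {f | ∀ i, i ≠ d → (f : Polynomial R).coeff i = 0}
  add_mem' hf hg i hi := by simp [hf i hi, hg i hi]
  zero_mem' i _ := by simp
  smul_mem' r f hf i hi := by simp [hf i hi]

theorem mem_reesGrading {d : ℕ} {f : reesAlgebra I} :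
    f ∈ reesGrading I d ↔ ∀ i, i ≠ d → (f : Polynomial R).coeff i = 0 := Iff.rfl

/-- The degree `d` component of an element of the Rees algebra. -/
def reesComponent (d : ℕ) (f : reesAlgebra I) : reesGrading I d :=
  ⟨⟨Polynomial.monomial d ((f : Polynomial R).coeff d), reesAlgebra.monomial_mem.mpr (f.2 d)⟩,
    fun _ hi => Polynomial.coeff_monomial_of_ne _ hi⟩

theorem coe_reesComponent (d : ℕ) (f : reesAlgebra I) :
    ((reesComponent I d f : reesAlgebra I) : Polynomial R) =
      Polynomial.monomial d ((f : Polynomial R).coeff d) := rfl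

instance reesGrading_gradedMonoid : SetLike.GradedMonoid (reesGrading I) where
  one_mem i hi := by simp [Polynomial.coeff_one, hi]
  mul_mem a b f g hf hg i hi := by
    rw [MulMemClass.coe_mul, Polynomial.coeff_mul]
    refine Finset.sum_eq_zero fun p hp => ?_
    rw [Finset.HasAntidiagonal.mem_antidiagonal] at hp
    by_cases h : p.1 = a
    · rw [hg p.2 (by omega), mul_zero]
    · rw [hf p.1 h, zero_mul]

theorem reesComponent_coe (x : DirectSum ℕ fun d => reesGrading I d) (d : ℕ) :
    reesComponent I d (DirectSum.coeAddMonoidHom (reesGrading I) x) = x d := by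
  induction x using DirectSum.induction_on with
  | zero =>
    apply Subtype.ext
    apply Subtype.ext
    simp [coe_reesComponent]
  | of e y =>
    rw [DirectSum.coeAddMonoidHom_of]
    apply Subtype.ext
    apply Subtype.ext
    rw [coe_reesComponent]
    by_cases h : d = e
    · subst h
      rw [DirectSum.of_eq_same]
      ext i
      by_cases hi : i = d
      · subst hi
        simp
      · rw [Polynomial.coeff_monomial_of_ne _ hi, y.2 i hi]
    · rw [DirectSum.of_eq_of_ne _ _ _ h, y.2 d h]
      simp
  | add x y hx hy =>
    rw [map_add, DirectSum.add_apply, ← hx, ← hy]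
    apply Subtype.ext
    apply Subtype.ext
    simp [coe_reesComponent]

instance reesGrading_decomposition : DirectSum.Decomposition (reesGrading I) where
  decompose' f := ∑ d ∈ (f : Polynomial R).support,
    DirectSum.of (fun d => reesGrading I d) d (reesComponent I d f)
  left_inv f := by
    apply Subtype.ext
    rw [map_sum]
    simp only [DirectSum.coeAddMonoidHom_of]
    rw [AddSubmonoidClass.coe_finsetSum]
    exact (f : Polynomial R).as_sum_support.symm
  right_inv x := by
    refine DFinsupp.ext fun d => ?_
    rw [← reesComponent_coe I x d]
    set f := DirectSum.coeAddMonoidHom (reesGrading I) x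
    change (∑ e ∈ (f : Polynomial R).support,
      DirectSum.of (fun d => reesGrading I d) e (reesComponent I e f)) d = _
    rw [DirectSum.sum_apply]
    by_cases hd : d ∈ (f : Polynomial R).support
    · rw [Finset.sum_eq_single_of_mem d hd fun e _ he => DirectSum.of_eq_of_ne _ _ _ he.symm,
        DirectSum.of_eq_same]
    · rw [Finset.sum_eq_zero fun e he =>
        DirectSum.of_eq_of_ne _ _ _ fun h => hd (by rw [h]; exact he)]
      apply Subtype.ext
      apply Subtype.ext
      rw [coe_reesComponent, Polynomial.notMem_support_iff.mp hd]
      simp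

/-- The Rees algebra as an `ℕ`-graded algebra. -/
instance reesGrading_gradedAlgebra : GradedAlgebra (reesGrading I) where

/-- The blowup of `Spec R` with center `I`: the scheme `Proj (⨁ I ^ d)`. -/
def blowup : Scheme.{u} := Proj (reesGrading I)

/-- The blowup map `π : Bl_I (Spec R) ⟶ Spec R`. -/
def blowupMap : blowup I ⟶ Spec (CommRingCat.of R) :=
  Proj.toSpecZero (reesGrading I) ≫
    Spec.map (CommRingCat.ofHom (algebraMap R (reesGrading I 0)))

end Rees

section Tame

variable {K : Type u} [Field K] {n : ℕ}

/-- An ideal of `K[x_1, …, x_n]` is tame if the blowup of `𝔸ⁿ = Spec K[x_1, …, x_n]` in this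
ideal is smooth, that is, its structure morphism to `Spec K` is smooth. -/
def IsTame (I : Ideal (MvPolynomial (Fin n) K)) : Prop :=
  Smooth (blowupMap I ≫
    Spec.map (CommRingCat.ofHom (algebraMap K (MvPolynomial (Fin n) K))))

variable (K)

/-- The coordinate ideal `(x_i : i ∈ S)` with cloud `S`. -/
def coordinateIdeal (S : Set (Fin n)) : Ideal (MvPolynomial (Fin n) K) :=
  Ideal.span (MvPolynomial.X '' S)

end Tame

end MonomialBlowup

end

/-! Everything takes place inside the coordinate ring `L` of the torus. For an ideal spanned by a
set `G` of monomials, the chart at `m ∈ G` embeds in `L` as `A = K[x, g/m : g ∈ G]`, and tameness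
means that all these algebras are smooth (`isTame_iff`, `smooth_toChart_iff`). The chart of the
product with `(x_j : j ∈ J)` at `m * x_l` is `A[x_j/x_l : j ∈ J]`. Give `x_j` degree 1 for `j ∈ J`
and the other variables degree 0. A generator of `∏ I_i` has degree `s`, as all clouds lie in `J`;
hence each `g/m` has degree 0, and `A` is generated in degrees 0 and 1. The core is
`Algebra.smooth_adjoin_div`. With `u = x_l`, let `B` be generated by the degree 0 generators of `A`
and the `x_j/u`. Then `B` is a retract of `A[1/u]` (divide degree `d` by `u ^ d`), hence smooth, and
the new chart is the polynomial ring `B[u]`. -/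

open Polynomial LaurentPolynomial

/-! ### Smoothness of retracts and of polynomial rings. -/

/-- A retract of a formally smooth algebra is formally smooth. -/
theorem Algebra.FormallySmooth.of_retract {R A B : Type*} [CommRing R] [CommRing A] [CommRing B]
    [Algebra R A] [Algebra R B] [Algebra.FormallySmooth R A] (i : B →ₐ[R] A) (r : A →ₐ[R] B)
    (h : r.comp i = AlgHom.id R B) : Algebra.FormallySmooth R B := by
  refine Algebra.FormallySmooth.of_comp_surjective fun C _ _ N hN f => ?_
  let g := Algebra.FormallySmooth.lift N ⟨2, hN⟩ (f.comp r)
  refine ⟨g.comp i, ?_⟩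
  have hg : (Ideal.Quotient.mkₐ R N).comp g = f.comp r := Algebra.FormallySmooth.comp_lift ..
  rw [← AlgHom.comp_assoc, hg, AlgHom.comp_assoc, h, AlgHom.comp_id]

/-- A retract of a smooth algebra over a Noetherian ring is smooth. -/
theorem Algebra.Smooth.of_retract {R A B : Type*} [CommRing R] [IsNoetherianRing R] [CommRing A]
    [CommRing B] [Algebra R A] [Algebra R B] [Algebra.Smooth R A] (i : B →ₐ[R] A) (r : A →ₐ[R] B)
    (h : r.comp i = AlgHom.id R B) : Algebra.Smooth R B where
  formallySmooth := Algebra.FormallySmooth.of_retract i r h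
  finitePresentation := by
    have hr : Function.Surjective r := fun b => ⟨i b, DFunLike.congr_fun h b⟩
    have : Algebra.FiniteType R B := Algebra.FiniteType.of_surjective r hr
    exact Algebra.FinitePresentation.of_finiteType.mp this

theorem Algebra.Smooth.polynomial (R A : Type*) [CommRing R] [CommRing A] [Algebra R A]
    [Algebra.Smooth R A] : Algebra.Smooth R A[X] :=
  have : Algebra.Smooth A A[X] := { finitePresentation := .polynomial A A }
  .comp R A A[X]

/-! ### Blowing up the degree 1 generators of a graded algebra. -/

section GradedBlowup

variable {K L : Type*} [Field K] [CommRing L] [Algebra K L]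

/-- Adjoining to a smooth subalgebra `A` the inverse of `u ∈ A`, a unit of the ambient ring,
gives a smooth subalgebra. -/
theorem Subalgebra.smooth_adjoin_inv (A : Subalgebra K L) [Algebra.Smooth K A] (u : Lˣ)
    (hu : (u : L) ∈ A) :
    ∃ D : Subalgebra K L, A ≤ D ∧ ((u⁻¹ : Lˣ) : L) ∈ D ∧ Algebra.Smooth K D ∧
      ∀ z ∈ D, ∃ k : ℕ, z * u ^ k ∈ A := by
  let a : A := ⟨u, hu⟩
  let f : Localization.Away a →ₐ[K] L := IsLocalization.liftAlgHom (M := Submonoid.powers a)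
    (f := A.val) (by
      rintro ⟨_, k, rfl⟩
      simpa [a] using (u.isUnit.pow k))
  have hf (x : A) : f (algebraMap A _ x) = x := IsLocalization.lift_eq _ _
  have hinj : Function.Injective f := by
    rw [injective_iff_map_eq_zero]
    intro x hx
    obtain ⟨⟨y, s⟩, hy⟩ := IsLocalization.surj (Submonoid.powers a) x
    have hy' := congrArg f hy
    rw [map_mul, hx, zero_mul, hf] at hy'
    have : y = 0 := Subtype.ext hy'.symm
    rw [this, map_zero] at hy
    exact (IsLocalization.map_units _ s).mul_left_eq_zero.mp hy
  have : Algebra.Smooth A (Localization.Away a) := .of_isLocalization_Away a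
  have : Algebra.Smooth K (Localization.Away a) := .comp K A _
  refine ⟨f.range, fun x hx => ⟨algebraMap A _ ⟨x, hx⟩, hf _⟩,
    ⟨IsLocalization.Away.invSelf a, ?_⟩,
    .of_equiv (AlgEquiv.ofInjective f hinj), ?_⟩
  · refine Units.eq_inv_of_mul_eq_one_left (?_ : (u : L) * f _ = 1)
    have := congrArg f (IsLocalization.Away.mul_invSelf (S := Localization.Away a) a)
    rw [map_mul, map_one, hf] at this
    exact this
  · rintro _ ⟨x, rfl⟩
    obtain ⟨⟨y, ⟨_, k, rfl⟩⟩, hy⟩ := IsLocalization.surj (Submonoid.powers a) x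
    refine ⟨k, ?_⟩
    have hy' := congrArg f hy
    rw [map_mul, hf, hf] at hy'
    have : f x * (u : L) ^ k = y := by simpa [a] using hy'
    change f x * (u : L) ^ k ∈ A
    rw [this]
    exact y.2

/-- Let `A = K[S₀ ∪ S₁]` be graded by means of a coaction `θ` of the multiplicative group, with
`S₀` in degree `0` and `S₁` in degree `1`. If `A` is smooth, then so is the affine chart
`A[s / u : s ∈ S₁]` of the blowup of `A` in the ideal generated by `S₁`. -/
theorem Algebra.smooth_adjoin_div (S₀ S₁ : Set L) (u : Lˣ) (hu : (u : L) ∈ S₁)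
    (θ : L →ₐ[K] L[T;T⁻¹]) (h₀ : ∀ s ∈ S₀, θ s = LaurentPolynomial.C s)
    (h₁ : ∀ s ∈ S₁, θ s = LaurentPolynomial.C s * LaurentPolynomial.T 1)
    [Algebra.Smooth K (Algebra.adjoin K (S₀ ∪ S₁))] :
    Algebra.Smooth K (Algebra.adjoin K
      (S₀ ∪ S₁ ∪ (fun s => s * ((u⁻¹ : Lˣ) : L)) '' S₁)) := by
  set Q : Set L := (fun s => s * ((u⁻¹ : Lˣ) : L)) '' S₁ with hQ
  let ev : L[T;T⁻¹] →ₐ[K] L :=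
    { LaurentPolynomial.eval₂ (RingHom.id L) u⁻¹ with
      commutes' := fun k => by
        change LaurentPolynomial.eval₂ (RingHom.id L) u⁻¹ (algebraMap K L[T;T⁻¹] k) = _
        rw [IsScalarTower.algebraMap_apply K L L[T;T⁻¹], ← LaurentPolynomial.C_eq_algebraMap]
        simp }
  have evC (x : L) : ev (LaurentPolynomial.C x) = x :=
    LaurentPolynomial.eval₂_C (RingHom.id L) u⁻¹ x
  have evT : ev (LaurentPolynomial.T 1) = ((u⁻¹ : Lˣ) : L) := by
    change LaurentPolynomial.eval₂ (RingHom.id L) u⁻¹ (LaurentPolynomial.T 1) = _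
    simp
  -- Setting `T = u⁻¹` in the coaction sends `z` of degree `d` to `z * u⁻¹ ^ d`; this is the
  -- retraction onto degree 0.
  let φ : L →ₐ[K] L := ev.comp θ
  have φ₀ (s) (hs : s ∈ S₀) : φ s = s := by simp [φ, h₀ s hs, evC]
  have φ₁ (s) (hs : s ∈ S₁) : φ s = s * ((u⁻¹ : Lˣ) : L) := by simp [φ, h₁ s hs, evC, evT]
  let B := Algebra.adjoin K (S₀ ∪ Q)
  have θB : ∀ b ∈ B, θ b = LaurentPolynomial.C b := by
    let CA : L →ₐ[K] L[T;T⁻¹] := Algebra.algHom K L _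
    have hCA (x) : CA x = LaurentPolynomial.C x := rfl
    have : B ≤ AlgHom.equalizer θ CA := by
      refine Algebra.adjoin_le ?_
      rintro s (hs | ⟨s, hs, rfl⟩)
      · exact h₀ s hs
      · change θ (s * _) = LaurentPolynomial.C (s * ((u⁻¹ : Lˣ) : L))
        have h1 : θ ((u⁻¹ : Lˣ) : L) * θ u = 1 := by rw [← map_mul]; simp
        have h2 : LaurentPolynomial.C ((u⁻¹ : Lˣ) : L) * LaurentPolynomial.C (u : L) = 1 := by
          rw [← map_mul]; simp
        rw [h₁ u hu] at h1
        rw [map_mul, map_mul, h₁ s hs]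
        linear_combination LaurentPolynomial.C s * LaurentPolynomial.C ((u⁻¹ : Lˣ) : L) * h1
          - LaurentPolynomial.C s * LaurentPolynomial.T 1 * θ ((u⁻¹ : Lˣ) : L) * h2
    exact this
  have φB (b) (hb : b ∈ B) : φ b = b := by simp [φ, θB b hb, evC]
  obtain ⟨D, hAD, huD, hD, hDA⟩ := Subalgebra.smooth_adjoin_inv
    (Algebra.adjoin K (S₀ ∪ S₁)) u (Algebra.subset_adjoin (Or.inr hu))
  have hBD : B ≤ D := by
    refine Algebra.adjoin_le ?_
    rintro s (hs | ⟨s, hs, rfl⟩)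
    · exact hAD (Algebra.subset_adjoin (Or.inl hs))
    · exact D.mul_mem (hAD (Algebra.subset_adjoin (Or.inr hs))) huD
  have hφA : Algebra.adjoin K (S₀ ∪ S₁) ≤ B.comap φ := by
    refine Algebra.adjoin_le ?_
    rintro s (hs | hs)
    · change φ s ∈ B
      rw [φ₀ s hs]
      exact Algebra.subset_adjoin (Or.inl hs)
    · change φ s ∈ B
      rw [φ₁ s hs]
      exact Algebra.subset_adjoin (Or.inr ⟨s, hs, rfl⟩)
  -- Since `φ u = 1`, multiplying `z` by a power of `u` to reach `A` does not change its image.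
  have hφD (z : D) : φ z ∈ B := by
    obtain ⟨k, hk⟩ := hDA z z.2
    have := hφA hk
    change φ _ ∈ B at this
    rwa [map_mul, map_pow, φ₁ u hu, Units.mul_inv, one_pow, mul_one] at this
  have hB : Algebra.Smooth K B :=
    .of_retract (Subalgebra.inclusion hBD) ((φ.comp D.val).codRestrict B hφD)
      (AlgHom.ext fun b => Subtype.ext (φB b b.2))
  have := Algebra.Smooth.polynomial K B
  let ψ : B[X] →ₐ[K] L := (Polynomial.aeval (R := B) (u : L)).restrictScalars K
  have ψX : ψ X = u := Polynomial.aeval_X _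
  have ψC (b : B) : ψ (Polynomial.C b) = b := Polynomial.aeval_C _ _
  have hψ : Function.Injective ψ := by
    -- Since `θ u = u * T`, the rescaling `T ↦ u⁻¹ * T` turns `θ u` into `T` while fixing `B`. The
    -- composite with `ψ` is then the evident inclusion of `B[X]` in `L[T;T⁻¹]`, so `u` is
    -- transcendental over `B`.
    let sc : L[T;T⁻¹] →+* L[T;T⁻¹] := LaurentPolynomial.eval₂ LaurentPolynomial.C
      (Units.map (LaurentPolynomial.C : L →+* L[T;T⁻¹]).toMonoidHom u⁻¹ *
        (LaurentPolynomial.isUnit_T 1).unit)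
    have scC (x : L) : sc (LaurentPolynomial.C x) = LaurentPolynomial.C x :=
      LaurentPolynomial.eval₂_C _ _ x
    have scT : sc (LaurentPolynomial.T 1) =
        LaurentPolynomial.C ((u⁻¹ : Lˣ) : L) * LaurentPolynomial.T 1 := by
      simp [sc]
    have key : (sc.comp (θ : L →+* L[T;T⁻¹])).comp (ψ : B[X] →+* L) =
        (Polynomial.toLaurent : L[X] →+* L[T;T⁻¹]).comp (Polynomial.mapRingHom B.val) := by
      refine Polynomial.ringHom_ext (fun b => ?_) ?_
      · simp [ψC, θB, scC]
      · simp only [RingHom.comp_apply, RingHom.coe_coe, ψX, h₁ u hu, map_mul, scC, scT,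
          Polynomial.coe_mapRingHom, Polynomial.map_X, Polynomial.toLaurent_X]
        rw [← mul_assoc, ← map_mul, Units.mul_inv, map_one, one_mul]
    have hinj : Function.Injective ((Polynomial.toLaurent : L[X] →+* L[T;T⁻¹]).comp
        (Polynomial.mapRingHom (B.val : B →+* L))) :=
      Polynomial.toLaurent_injective.comp (Polynomial.map_injective _ Subtype.val_injective)
    rw [← key] at hinj
    exact fun p q (hpq : ψ p = ψ q) => hinj (congrArg (fun x => sc (θ x)) hpq)
  have hrange : ψ.range = Algebra.adjoin K (S₀ ∪ S₁ ∪ Q) := by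
    refine le_antisymm ?_ (Algebra.adjoin_le ?_)
    · rintro _ ⟨p, rfl⟩
      change ψ p ∈ Algebra.adjoin K (S₀ ∪ S₁ ∪ Q)
      have hBA : B ≤ Algebra.adjoin K (S₀ ∪ S₁ ∪ Q) := Algebra.adjoin_mono (by grind)
      induction p using Polynomial.induction_on' with
      | add p q hp hq => rw [map_add]; exact add_mem hp hq
      | monomial k b =>
        rw [← Polynomial.C_mul_X_pow_eq_monomial, map_mul, map_pow, ψX, ψC]
        have huA : (u : L) ∈ Algebra.adjoin K (S₀ ∪ S₁ ∪ Q) :=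
          Algebra.subset_adjoin (Or.inl (Or.inr hu))
        exact mul_mem (hBA b.2) (pow_mem huA k)
    · have hB (b) (hb : b ∈ B) : b ∈ ψ.range := ⟨Polynomial.C ⟨b, hb⟩, ψC _⟩
      rintro s ((hs | hs) | hs)
      · exact hB s (Algebra.subset_adjoin (Or.inl hs))
      · have := ψ.range.mul_mem (hB _ (Algebra.subset_adjoin (Or.inr ⟨s, hs, rfl⟩))) ⟨X, ψX⟩
        simpa using this
      · exact hB s (Algebra.subset_adjoin (Or.inr hs))
  rw [← hrange]
  exact .of_equiv (AlgEquiv.ofInjective ψ hψ)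

end GradedBlowup

namespace MonomialBlowup

/-! ### Affine charts of a blowup as subalgebras of a larger ring. -/

section Chart

variable {R : Type u} [CommRing R] (I : Ideal R)

/-- The element `m t` of degree `1` of the Rees algebra. -/
noncomputable def reesOne (m : R) (hm : m ∈ I) : reesAlgebra I :=
  ⟨Polynomial.monomial 1 m, reesAlgebra.monomial_mem.mpr (by rwa [pow_one])⟩

theorem reesOne_mem (m : R) (hm : m ∈ I) : reesOne I m hm ∈ reesGrading I 1 :=
  fun _ hi => Polynomial.coeff_monomial_of_ne _ hi

/-- The structure map from `R` to the affine chart `D₊(m t)` of the blowup of `I`. -/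
noncomputable def toChart (m : R) (hm : m ∈ I) :
    R →+* HomogeneousLocalization.Away (reesGrading I) (reesOne I m hm) :=
  (HomogeneousLocalization.fromZeroRingHom (reesGrading I) _).comp
    (algebraMap R (reesGrading I 0))

section Embedding

variable {L : Type*} [CommRing L] [Algebra R L] (m : R) (hm : m ∈ I) (v : Lˣ)
  (hv : algebraMap R L m = v)

/-- The evaluation `t ↦ m⁻¹` on the Rees algebra. -/
noncomputable def reesEval : reesAlgebra I →+* L :=
  (Polynomial.eval₂RingHom (algebraMap R L) ((v⁻¹ : Lˣ) : L)).comp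
    (reesAlgebra I).toSubring.subtype

theorem reesEval_apply (f : reesAlgebra I) :
    reesEval I v f = Polynomial.eval₂ (algebraMap R L) ((v⁻¹ : Lˣ) : L) (f : Polynomial R) := rfl

theorem reesEval_reesOne (m : R) (hm : m ∈ I) (v : Lˣ) (hv : algebraMap R L m = v) :
    reesEval I v (reesOne I m hm) = 1 := by
  simp [reesEval_apply, reesOne, hv]

/-- The map from the chart `D₊(m t)` to `L` which sends `a t ^ d / (m t) ^ d` to `a / m ^ d`. -/
noncomputable def chartEval :
    HomogeneousLocalization.Away (reesGrading I) (reesOne I m hm) →+* L :=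
  (IsLocalization.Away.lift (S := Localization.Away (reesOne I m hm)) (reesOne I m hm)
    (g := reesEval I v) ((reesEval_reesOne I m hm v hv).symm ▸ isUnit_one)).comp
    (algebraMap _ _)

theorem chartEval_mk (d : ℕ) (a : reesAlgebra I) (ha : a ∈ reesGrading I (d • 1)) :
    chartEval I m hm v hv (.mk _ (reesOne_mem I m hm) d a ha) = reesEval I v a := by
  rw [chartEval, RingHom.comp_apply, HomogeneousLocalization.algebraMap_apply,
    HomogeneousLocalization.Away.val_mk, Localization.mk_eq_mk', IsLocalization.Away.lift,
    IsLocalization.lift_mk'_spec]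
  simp [reesEval_reesOne I m hm v hv]

theorem chartEval_toChart (r : R) :
    chartEval I m hm v hv (toChart I m hm r) = algebraMap R L r := by
  have : toChart I m hm r = .mk _ (reesOne_mem I m hm) 0 (algebraMap R (reesAlgebra I) r)
      (by rw [zero_smul]; exact (algebraMap R (reesGrading I 0) r).2) := by
    ext
    simp [toChart, HomogeneousLocalization.fromZeroRingHom]
    rfl
  rw [this, chartEval_mk, reesEval_apply]
  exact Polynomial.eval₂_C _ _

/-- A homogeneous element of the Rees algebra is determined by its leading coefficient. -/
theorem coe_eq_monomial {d : ℕ} {a : reesAlgebra I} (ha : a ∈ reesGrading I d) :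
    (a : Polynomial R) = Polynomial.monomial d ((a : Polynomial R).coeff d) := by
  ext i
  by_cases hi : i = d
  · subst hi; simp
  · rw [Polynomial.coeff_monomial_of_ne _ hi, ha i hi]

/-- A chart element is a single fraction `a t ^ d / (m t) ^ d`, with image `a / m ^ d`; as `m`
becomes a unit in `L`, this vanishes only for `a = 0`. -/
theorem chartEval_injective (hinj : Function.Injective (algebraMap R L)) :
    Function.Injective (chartEval I m hm v hv) := by
  rw [injective_iff_map_eq_zero]
  intro x hx
  obtain ⟨d, a, ha, rfl⟩ := HomogeneousLocalization.Away.mk_surjective _ (reesOne_mem I m hm) x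
  rw [chartEval_mk, reesEval_apply, coe_eq_monomial I ha, Polynomial.eval₂_monomial,
    ← Units.val_pow_eq_pow_val, Units.mul_left_eq_zero, map_eq_zero_iff _ hinj] at hx
  have : a = 0 := Subtype.ext (by rw [coe_eq_monomial I ha, hx]; simp)
  subst this
  ext
  simp [Localization.mk_zero]

variable {K : Type*} [CommRing K] [Algebra K R] [Algebra K L] [IsScalarTower K R L]

theorem range_chartEval (G : Set R) (hG : I = Ideal.span G) (P : Set R)
    (hP : Algebra.adjoin K P = ⊤) :
    Set.range (chartEval I m hm v hv) = Algebra.adjoin K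
      (algebraMap R L '' P ∪ (fun g => algebraMap R L g * ((v⁻¹ : Lˣ) : L)) '' G) := by
  set Q := Algebra.adjoin K
      (algebraMap R L '' P ∪ (fun g => algebraMap R L g * ((v⁻¹ : Lˣ) : L)) '' G) with hQ
  have hRQ (r : R) : algebraMap R L r ∈ Q := by
    have : Algebra.adjoin K P ≤ Q.comap (IsScalarTower.toAlgHom K R L) :=
      Algebra.adjoin_le fun p hp => Algebra.subset_adjoin (Or.inl ⟨p, hp, rfl⟩)
    rw [hP] at this
    exact this (Algebra.mem_top (x := r))
  apply Set.Subset.antisymm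
  · rintro _ ⟨x, rfl⟩
    obtain ⟨d, a, ha, rfl⟩ := HomogeneousLocalization.Away.mk_surjective _ (reesOne_mem I m hm) x
    rw [chartEval_mk, reesEval_apply, coe_eq_monomial I ha, Polynomial.eval₂_monomial]
    have hc := a.2 (d • 1)
    generalize (a : Polynomial R).coeff (d • 1) = c at hc
    rw [smul_eq_mul, mul_one] at hc ⊢
    clear ha a
    have hI (b : R) (hb : b ∈ I) : algebraMap R L b * ((v⁻¹ : Lˣ) : L) ∈ Q := by
      rw [hG] at hb
      induction hb using Submodule.span_induction with
      | mem g hg => exact Algebra.subset_adjoin (Or.inr ⟨g, hg, rfl⟩)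
      | zero => simp
      | add x y _ _ hx hy => rw [map_add, add_mul]; exact add_mem hx hy
      | smul r x _ hx => rw [smul_eq_mul, map_mul, mul_assoc]; exact mul_mem (hRQ r) hx
    -- `c / m ^ d` with `c ∈ I ^ d` is a sum of products of `d` fractions `b / m` with `b ∈ I`.
    induction d generalizing c with
    | zero => simpa using hRQ c
    | succ d ih =>
      rw [pow_succ] at hc
      induction hc using Submodule.mul_induction_on' with
      | mem_mul_mem x hx y hy =>
        have := mul_mem (ih x hx) (hI y hy)
        rw [map_mul, pow_succ, mul_mul_mul_comm]
        exact this
      | add x _ y _ hx hy => rw [map_add, add_mul]; exact add_mem hx hy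
  · let _ : Algebra K (HomogeneousLocalization.Away (reesGrading I) (reesOne I m hm)) :=
      ((toChart I m hm).comp (algebraMap K R)).toAlgebra
    let f : HomogeneousLocalization.Away (reesGrading I) (reesOne I m hm) →ₐ[K] L :=
      { chartEval I m hm v hv with
        commutes' := fun k => by
          change chartEval I m hm v hv (toChart I m hm (algebraMap K R k)) = _
          rw [chartEval_toChart, ← IsScalarTower.algebraMap_apply] }
    have : Q ≤ f.range := by
      refine Algebra.adjoin_le ?_
      rintro _ (⟨p, hp, rfl⟩ | ⟨g, hg, rfl⟩)
      · exact ⟨toChart I m hm p, chartEval_toChart I m hm v hv p⟩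
      · have hgI : g ∈ I := hG ▸ Ideal.subset_span hg
        refine ⟨.mk _ (reesOne_mem I m hm) 1 (reesOne I g hgI)
          (by rw [one_smul]; exact reesOne_mem I g hgI), (chartEval_mk I m hm v hv _ _ _).trans ?_⟩
        rw [reesEval_apply]
        exact Polynomial.eval₂_monomial ..  |>.trans (by rw [pow_one])
    exact this

/-- The chart `D₊(m t)` of the blowup of `I = (G)` is smooth over `K` if and only if the
`K`-algebra `R[g / m : g ∈ G]` is smooth. -/
theorem smooth_toChart_iff (m : R) (hm : m ∈ I) (v : Lˣ)
    (hv : algebraMap R L m = v) (hinj : Function.Injective (algebraMap R L)) (G : Set R)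
    (hG : I = Ideal.span G) (P : Set R) (hP : Algebra.adjoin K P = ⊤) :
    ((toChart I m hm).comp (algebraMap K R)).Smooth ↔ Algebra.Smooth K (Algebra.adjoin K
      (algebraMap R L '' P ∪ (fun g => algebraMap R L g * ((v⁻¹ : Lˣ) : L)) '' G)) := by
  let _ : Algebra K (HomogeneousLocalization.Away (reesGrading I) (reesOne I m hm)) :=
    ((toChart I m hm).comp (algebraMap K R)).toAlgebra
  let f : HomogeneousLocalization.Away (reesGrading I) (reesOne I m hm) →ₐ[K] L :=
    { chartEval I m hm v hv with
      commutes' := fun k => by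
        change chartEval I m hm v hv (toChart I m hm (algebraMap K R k)) = _
        rw [chartEval_toChart, ← IsScalarTower.algebraMap_apply] }
  have hf : f.range = Algebra.adjoin K
      (algebraMap R L '' P ∪ (fun g => algebraMap R L g * ((v⁻¹ : Lˣ) : L)) '' G) :=
    SetLike.coe_injective (range_chartEval I m hm v hv G hG P hP)
  have e := AlgEquiv.ofInjective f (chartEval_injective I m hm v hv hinj)
  rw [hf] at e
  exact ⟨fun (_ : Algebra.Smooth K _) => .of_equiv e,
    fun _ => (Algebra.Smooth.of_equiv e.symm : Algebra.Smooth K _)⟩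

end Embedding

end Chart

end MonomialBlowup

namespace MonomialBlowup

/-! ### Generators of the ideal give charts that cover the blowup. -/

section Cover

variable {R : Type u} [CommRing R] (I : Ideal R)

/-- The reason is the factorization `x y t ^ (d + 1) = (x t) (y t ^ d)` for `x ∈ I` and `y ∈ I ^ d`.
-/
theorem monomial_mem_span_reesOne (G : Set R) (hG : I = Ideal.span G) (d : ℕ) (c : R)
    (hc : c ∈ I ^ (d + 1)) :
    (⟨Polynomial.monomial (d + 1) c, reesAlgebra.monomial_mem.mpr hc⟩ : reesAlgebra I) ∈
      Ideal.span (Set.range fun g : G => reesOne I g (hG ▸ Ideal.subset_span g.2)) := by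
  set N := Ideal.span (Set.range fun g : G => reesOne I (g : R) (hG ▸ Ideal.subset_span g.2))
  have h1 (b : R) (hb : b ∈ I) : reesOne I b hb ∈ N := by
    subst hG
    induction hb using Submodule.span_induction with
    | mem g hg => exact Ideal.subset_span ⟨⟨g, hg⟩, rfl⟩
    | zero =>
      convert N.zero_mem
      apply Subtype.ext
      simp [reesOne]
    | add x y hx hy hx' hy' =>
      convert N.add_mem hx' hy'
      apply Subtype.ext
      simp [reesOne]
    | smul r x hx hx' =>
      convert N.mul_mem_left (algebraMap R _ r) hx'
      apply Subtype.ext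
      simp [reesOne]
  rw [pow_succ'] at hc
  -- Quantifying over `f` frees the goal from the membership proof `hc`, so that induction on `hc`
  -- is possible.
  suffices ∀ f : reesAlgebra I, (f : Polynomial R) = Polynomial.monomial (d + 1) c → f ∈ N from
    this _ rfl
  induction hc using Submodule.mul_induction_on' with
  | mem_mul_mem x hx y hy =>
    intro f hf
    have hfe : f = reesOne I x hx * ⟨Polynomial.monomial d y, reesAlgebra.monomial_mem.mpr hy⟩ := by
      apply Subtype.ext
      rw [hf, MulMemClass.coe_mul]
      simp only [reesOne]
      rw [Polynomial.monomial_mul_monomial, add_comm]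
    rw [hfe]
    exact N.mul_mem_right _ (h1 x hx)
  | add x hx' y hy' hx hy =>
    intro f hf
    rw [← pow_succ'] at hx' hy'
    have hfe : f = ⟨Polynomial.monomial (d + 1) x, reesAlgebra.monomial_mem.mpr hx'⟩ +
        ⟨Polynomial.monomial (d + 1) y, reesAlgebra.monomial_mem.mpr hy'⟩ := by
      apply Subtype.ext
      rw [hf, map_add]
      rfl
    rw [hfe]
    exact N.add_mem (hx hx' _ rfl) (hy hy' _ rfl)

theorem irrelevant_le_span_reesOne (G : Set R) (hG : I = Ideal.span G) :
    (HomogeneousIdeal.irrelevant (reesGrading I)).toIdeal ≤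
      Ideal.span (Set.range fun g : G => reesOne I g (hG ▸ Ideal.subset_span g.2)) := by
  classical
  intro f hf
  rw [← DirectSum.sum_support_decompose (reesGrading I) f]
  refine Ideal.sum_mem _ fun d _ => ?_
  obtain _ | d := d
  · have : (DirectSum.decompose (reesGrading I) f 0 : reesAlgebra I) = 0 := hf
    rw [this]
    exact zero_mem _
  · have hmem := (DirectSum.decompose (reesGrading I) f (d + 1)).2
    have := coe_eq_monomial I hmem
    have h := monomial_mem_span_reesOne I G hG d _
      ((DirectSum.decompose (reesGrading I) f (d + 1) : reesAlgebra I).2 (d + 1))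
    convert h using 1
    exact Subtype.ext this

end Cover

/-! ### Tameness on charts, and the torus with its coaction. -/

variable {K : Type u} [Field K] {n : ℕ}

/-- Tameness can be checked on the affine charts given by generators of the ideal. -/
theorem isTame_iff (I : Ideal (MvPolynomial (Fin n) K)) (G : Set (MvPolynomial (Fin n) K))
    (hG : I = Ideal.span G) :
    IsTame I ↔ ∀ g : G, ((toChart I (g : MvPolynomial (Fin n) K)
      (hG ▸ Ideal.subset_span g.2)).comp (algebraMap K _)).Smooth := by
  let U := Proj.affineOpenCoverOfIrrelevantLESpan (reesGrading I)
    (fun g : G => reesOne I g (hG ▸ Ideal.subset_span g.2)) (m := fun _ => 1)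
    (fun g => reesOne_mem I g _) (fun _ => one_pos) (irrelevant_le_span_reesOne I G hG)
  have hloc : IsZariskiLocalAtSource @Smooth.{u} := HasRingHomProperty.instIsZariskiLocalAtSource
  refine (IsZariskiLocalAtSource.iff_of_openCover (P := @Smooth.{u}) (𝒰 := U.openCover)).trans ?_
  refine forall_congr' fun (g : G) => ?_
  have : U.openCover.f g ≫ blowupMap I ≫
      Spec.map (CommRingCat.ofHom (algebraMap K (MvPolynomial (Fin n) K))) =
      Spec.map (CommRingCat.ofHom ((toChart I (g : MvPolynomial (Fin n) K)
        (hG ▸ Ideal.subset_span g.2)).comp (algebraMap K _))) := by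
    change Proj.awayι (reesGrading I) _ (reesOne_mem I g _) one_pos ≫
      (Proj.toSpecZero (reesGrading I) ≫ _) ≫ _ = _
    rw [Category.assoc, Proj.awayι_toSpecZero_assoc, ← Spec.map_comp, ← Spec.map_comp]
    rfl
  exact (iff_of_eq (congrArg (fun h => Smooth h) this)).trans
    (HasRingHomProperty.Spec_iff (P := @Smooth.{u}))

/-- The coordinate ring of the torus, obtained by inverting all variables. -/
abbrev Torus (K : Type u) [Field K] (n : ℕ) : Type u :=
  Localization.Away (∏ i, MvPolynomial.X i : MvPolynomial (Fin n) K)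

theorem isUnit_algebraMap_X (i : Fin n) :
    IsUnit (algebraMap (MvPolynomial (Fin n) K) (Torus K n) (MvPolynomial.X i)) :=
  isUnit_of_dvd_unit (map_dvd _ (Finset.dvd_prod_of_mem _ (Finset.mem_univ i)))
    (IsLocalization.Away.algebraMap_isUnit _)

theorem algebraMap_torus_injective :
    Function.Injective (algebraMap (MvPolynomial (Fin n) K) (Torus K n)) :=
  IsLocalization.injective (M := Submonoid.powers
    (∏ i, MvPolynomial.X i : MvPolynomial (Fin n) K)) _ (powers_le_nonZeroDivisors_of_noZeroDivisors
    (Finset.prod_ne_zero_iff.mpr fun i _ => MvPolynomial.X_ne_zero i))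

open scoped Classical LaurentPolynomial in
/-- The coaction on the torus which gives the variables `x_j`, `j ∈ J`, degree `1` and the others
degree `0`. -/
theorem exists_coaction (J : Set (Fin n)) :
    ∃ θ : Torus K n →ₐ[K] (Torus K n)[T;T⁻¹], ∀ i,
      θ (algebraMap (MvPolynomial (Fin n) K) (Torus K n) (MvPolynomial.X i)) =
        LaurentPolynomial.C (algebraMap (MvPolynomial (Fin n) K) (Torus K n) (MvPolynomial.X i)) *
          if i ∈ J then LaurentPolynomial.T 1 else 1 := by
  let w (i : Fin n) : (Torus K n)[T;T⁻¹] :=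
    LaurentPolynomial.C (algebraMap (MvPolynomial (Fin n) K) _ (MvPolynomial.X i)) *
      if i ∈ J then LaurentPolynomial.T 1 else 1
  have hw (i) : IsUnit (w i) := by
    refine ((isUnit_algebraMap_X i).map LaurentPolynomial.C).mul ?_
    split_ifs
    exacts [LaurentPolynomial.isUnit_T 1, isUnit_one]
  refine ⟨IsLocalization.liftAlgHom
    (M := Submonoid.powers (∏ i, MvPolynomial.X i : MvPolynomial (Fin n) K))
    (f := MvPolynomial.aeval w) ?_, fun i => ?_⟩
  · rintro ⟨_, k, rfl⟩
    simp only [map_pow, map_prod, MvPolynomial.aeval_X]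
    exact (IsUnit.prod_univ_iff.mpr hw).pow k
  · exact (IsLocalization.lift_eq _ _).trans (MvPolynomial.aeval_X w i)

open scoped Pointwise in
/-- The product of an ideal generated by monomials of the same degree in the variables `x_j`,
`j ∈ J`, with the coordinate ideal of `J` is tame if the given ideal is tame. -/
theorem IsTame.mul_coordinateIdeal {s : ℕ} {J : Set (Fin n)}
    {G : Set (MvPolynomial (Fin n) K)}
    (hG : ∀ g ∈ G, ∃ k : Fin s → Fin n, (∀ i, k i ∈ J) ∧ g = ∏ i, MvPolynomial.X (k i))
    (h : IsTame (Ideal.span G)) : IsTame (Ideal.span G * coordinateIdeal K J) := by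
  have hspan : Ideal.span G * coordinateIdeal K J =
      Ideal.span (G * MvPolynomial.X '' J) := Ideal.span_mul_span' _ _
  rw [isTame_iff _ _ rfl] at h
  rw [isTame_iff _ _ hspan]
  rintro ⟨_, ⟨m, hm, _, ⟨l, hl, rfl⟩, rfl⟩⟩
  let x (i : Fin n) : Torus K n := algebraMap (MvPolynomial (Fin n) K) _ (MvPolynomial.X i)
  have hGu (g) (hg : g ∈ G) : IsUnit (algebraMap (MvPolynomial (Fin n) K) (Torus K n) g) := by
    obtain ⟨k, -, rfl⟩ := hG g hg
    rw [map_prod]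
    exact IsUnit.prod_univ_iff.mpr fun i => isUnit_algebraMap_X _
  obtain ⟨v, hv⟩ := hGu m hm
  obtain ⟨u, hu⟩ : IsUnit (x l) := isUnit_algebraMap_X l
  obtain ⟨θ, hθ⟩ := exists_coaction (K := K) J
  have hθG (g) (hg : g ∈ G) : θ (algebraMap (MvPolynomial (Fin n) K) _ g) =
      LaurentPolynomial.C (algebraMap (MvPolynomial (Fin n) K) _ g) * LaurentPolynomial.T 1 ^ s := by
    obtain ⟨k, hk, rfl⟩ := hG g hg
    simp only [map_prod, hθ, hk, if_true, Finset.prod_mul_distrib, Finset.prod_const,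
      Finset.card_univ, Fintype.card_fin]
  let D : Set (Torus K n) := (fun g =>
    algebraMap (MvPolynomial (Fin n) K) _ g * ((v⁻¹ : (Torus K n)ˣ) : Torus K n)) '' G
  have hP : Algebra.adjoin K (Set.range (MvPolynomial.X : Fin n → MvPolynomial (Fin n) K)) = ⊤ :=
    MvPolynomial.adjoin_range_X
  have hA := (smooth_toChart_iff (K := K) _ m (Ideal.subset_span hm) v hv.symm
    algebraMap_torus_injective G rfl _ hP).mp (h ⟨m, hm⟩)
  -- The generators of the old chart, sorted into degree 0 and degree 1.
  have hgen : algebraMap (MvPolynomial (Fin n) K) (Torus K n) '' Set.range MvPolynomial.X ∪ D =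
      (x '' Jᶜ ∪ D) ∪ x '' J := by
    rw [← Set.range_comp, Set.union_right_comm, ← Set.image_union, Set.compl_union_self,
      Set.image_univ]
    rfl
  change Algebra.Smooth K (Algebra.adjoin K (_ ∪ D)) at hA
  rw [hgen] at hA
  have hA' := Algebra.smooth_adjoin_div (x '' Jᶜ ∪ D) (x '' J) u ⟨l, hl, hu.symm⟩ θ
    (by
      rintro _ (⟨i, hi, rfl⟩ | ⟨g, hg, rfl⟩)
      · rw [hθ, if_neg hi, mul_one]
      -- `θ` multiplies both `g` and `m` by `T ^ s`, so the powers cancel in `g/m`.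
      · have h1 : θ (v : Torus K n) * θ ((v⁻¹ : (Torus K n)ˣ) : Torus K n) = 1 := by
          rw [← map_mul]; simp
        have h2 : LaurentPolynomial.C (v : Torus K n) *
            LaurentPolynomial.C ((v⁻¹ : (Torus K n)ˣ) : Torus K n) = 1 := by
          rw [← map_mul]; simp
        rw [hv, hθG m hm, ← hv] at h1
        dsimp only
        rw [map_mul, hθG g hg, map_mul]
        linear_combination LaurentPolynomial.C (algebraMap (MvPolynomial (Fin n) K) (Torus K n) g) *
          LaurentPolynomial.C ((v⁻¹ : (Torus K n)ˣ) : Torus K n) * h1 -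
          LaurentPolynomial.C (algebraMap (MvPolynomial (Fin n) K) (Torus K n) g) *
          LaurentPolynomial.T 1 ^ s *
          θ ((v⁻¹ : (Torus K n)ˣ) : Torus K n) * h2)
    (by
      rintro _ ⟨i, hi, rfl⟩
      rw [hθ, if_pos hi])
  rw [smooth_toChart_iff (K := K) _ _ _ (v * u) (by rw [map_mul, Units.val_mul, hv, hu])
    algebraMap_torus_injective _ hspan _ hP]
  rw [← hgen] at hA'
  refine (congrArg (fun S : Subalgebra K (Torus K n) => Algebra.Smooth K S) ?_).mpr hA'
  -- Each new fraction factors as `(g/m) * (x_i/x_l)`; conversely `i = l` recovers `g/m`, and `g =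
  -- m` recovers `x_i/x_l`.
  apply le_antisymm
  · refine Algebra.adjoin_le ?_
    rintro _ (hs | ⟨_, ⟨g, hg, _, ⟨i, hi, rfl⟩, rfl⟩, rfl⟩)
    · exact Algebra.subset_adjoin (Or.inl (Or.inl hs))
    · dsimp only
      rw [map_mul, mul_inv, Units.val_mul, mul_mul_mul_comm]
      refine mul_mem (Algebra.subset_adjoin ?_) (Algebra.subset_adjoin ?_)
      exacts [Or.inl (Or.inr ⟨g, hg, rfl⟩), Or.inr ⟨x i, ⟨i, hi, rfl⟩, rfl⟩]
  · refine Algebra.adjoin_le ?_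
    rintro _ ((hs | ⟨g, hg, rfl⟩) | ⟨_, ⟨i, hi, rfl⟩, rfl⟩)
    · exact Algebra.subset_adjoin (Or.inl hs)
    · refine Algebra.subset_adjoin (Or.inr
        ⟨g * MvPolynomial.X l, Set.mul_mem_mul hg ⟨l, hl, rfl⟩, ?_⟩)
      dsimp only
      rw [map_mul, mul_inv, Units.val_mul, mul_mul_mul_comm]
      change _ * (x l * _) = _
      rw [← hu, Units.mul_inv, mul_one]
    · refine Algebra.subset_adjoin (Or.inr
        ⟨m * MvPolynomial.X i, Set.mul_mem_mul hm ⟨i, hi, rfl⟩, ?_⟩)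
      dsimp only
      rw [map_mul, mul_inv, Units.val_mul, mul_mul_mul_comm, ← hv, Units.mul_inv, one_mul]

/-! ### The unit ideal and products of coordinate ideals. -/

theorem isTame_top : IsTame (⊤ : Ideal (MvPolynomial (Fin n) K)) := by
  -- With the single generator `1` the only chart is the polynomial ring itself.
  rw [isTame_iff ⊤ {1} Ideal.span_singleton_one.symm]
  rintro ⟨_, rfl⟩
  rw [smooth_toChart_iff (K := K) (L := MvPolynomial (Fin n) K) _ _ _ 1 (by simp)
    Function.injective_id _ Ideal.span_singleton_one.symm _ MvPolynomial.adjoin_range_X]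
  have : Algebra.adjoin K (algebraMap (MvPolynomial (Fin n) K) (MvPolynomial (Fin n) K) ''
      Set.range MvPolynomial.X ∪ (fun g => algebraMap (MvPolynomial (Fin n) K) _ g *
        (((1 : (MvPolynomial (Fin n) K)ˣ)⁻¹ : (MvPolynomial (Fin n) K)ˣ) :
          MvPolynomial (Fin n) K)) '' {1}) = ⊤ := by
    rw [eq_top_iff, ← MvPolynomial.adjoin_range_X]
    exact Algebra.adjoin_mono (by simp)
  rw [this]
  have : Algebra.Smooth K (MvPolynomial (Fin n) K) := { }
  exact .of_equiv Subalgebra.topEquiv.symm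

theorem coordinateIdeal_le_iff {I J : Set (Fin n)} :
    coordinateIdeal K I ≤ coordinateIdeal K J ↔ I ⊆ J := by
  refine ⟨fun h i hi => ?_, fun h => Ideal.span_mono (Set.image_mono h)⟩
  have := h (Ideal.subset_span ⟨i, hi, rfl⟩)
  rw [coordinateIdeal, MvPolynomial.mem_ideal_span_X_image] at this
  obtain ⟨j, hj, hj'⟩ := this (Finsupp.single i 1) (by simp [MvPolynomial.X])
  rw [Finsupp.single_apply_ne_zero] at hj'
  exact hj'.1 ▸ hj

-- The product is spanned by the monomials obtained by choosing one variable from each cloud; these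
-- all have `s` factors, each from `J`, as `IsTame.mul_coordinateIdeal` requires.
open scoped Pointwise in
theorem isTame_prod_mul {s : ℕ} (I : Fin s → Set (Fin n)) (J : Set (Fin n)) (hIJ : ∀ i, I i ⊆ J)
    (h : IsTame (∏ i, coordinateIdeal K (I i))) :
    IsTame ((∏ i, coordinateIdeal K (I i)) * coordinateIdeal K J) := by
  have hspan : ∏ i, coordinateIdeal K (I i) = Ideal.span (∏ i, MvPolynomial.X '' I i) :=
    Ideal.prod_span _ _
  rw [hspan] at h ⊢
  refine h.mul_coordinateIdeal (s := s) fun g hg => ?_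
  obtain ⟨f, hf, rfl⟩ := (Set.mem_fintype_prod _ _).mp hg
  choose k hk hk' using hf
  exact ⟨k, fun i => hIJ i (hk i), Finset.prod_congr rfl fun i _ => (hk' i).symm⟩

end MonomialBlowup

theorem mainTheorem8 (K : Type u) [Field K] (n : ℕ) :
    (∀ (s : ℕ) (I : Fin s → Set (Fin n)) (J : Set (Fin n)),
      (∀ i, MonomialBlowup.coordinateIdeal K (I i) ≤ MonomialBlowup.coordinateIdeal K J) →
      MonomialBlowup.IsTame (∏ i, MonomialBlowup.coordinateIdeal K (I i)) →
      MonomialBlowup.IsTame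
        ((∏ i, MonomialBlowup.coordinateIdeal K (I i)) * MonomialBlowup.coordinateIdeal K J)) ∧
    (∀ I J : Set (Fin n), I ⊆ J →
      MonomialBlowup.IsTame
        (MonomialBlowup.coordinateIdeal K I * MonomialBlowup.coordinateIdeal K J)) := by
  refine ⟨fun s I J hIJ => MonomialBlowup.isTame_prod_mul I J fun i =>
    MonomialBlowup.coordinateIdeal_le_iff.mp (hIJ i), fun I J hIJ => ?_⟩
  -- Part (b) applies (a) twice: the empty product is the tame unit ideal, so the ideal of `I` is
  -- tame; then the one-factor product is multiplied by the ideal of `J`.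
  have h0 := MonomialBlowup.isTame_prod_mul (K := K) (n := n) (s := 0) ![] I (fun i => i.elim0)
    (by simpa using MonomialBlowup.isTame_top)
  have h1 := MonomialBlowup.isTame_prod_mul (K := K) (s := 1) ![I] J (by simpa using hIJ)
    (by simpa using h0)
  simpa using h1
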